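/- Let $k$ be a field embedded in $\mathbb{C}$, let $\bar k$ be an algebraic closure of $k$, and let $f\in k[x,y]$ be tame: for some positive integral weights $\deg x=\alpha_1$, $\deg y=\alpha_2$, the highest-degree weighted homogeneous piece $g$ of $f$ has a finite dimensional Milnor vector space $k[x,y]/\langle g_x,g_y\rangle$. Suppose that the complex curve $f=0$ in $\mathbb{C}^2$ is smooth or that all its singular points are quasi-homogeneous; here a singular point $p$ is quasi-homogeneous if there are local holomorphic coordinates $u,v$ of $\mathbb{C}^2$ centred at $p$ such that near $p$ one has $f=a\cdot h(u,v)$, with $a$ holomorphic, $a(p)\neq 0$, and $h$ a polynomial that is homogeneous of non-zero degree for some integral weights of its two variables. Let $$E_f=\{\omega\in\Omega^1_{\mathbb{A}^2_k} : df\wedge\omega=f\alpha\ \text{ for some } \alpha\in\Omega^2_{\mathbb{A}^2_k}\},$$ a $k[x,y]$-module. Then the $\bar k[x,y]$-module $E_f\otimes_k\bar k$ is free of rank $2$. Moreover there is a finite extension $K$ of $k$, contained in $\bar k$, such that the $K[x,y]$-module $E_f\otimes_k K$ is free of rank $2$ and the curve $f=0$ over $K$ is a free divisor, that is, $f$ is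 square-free in $K[x,y]$ and the $K[x,y]$-module of vector fields $\theta$ on $\mathbb{A}^2_K$ with $f\mid\theta(f)$ is free. -/

import Mathlib

open scoped TensorProduct

noncomputable section

namespace TamePlaneCurve

/-- The polynomial ring `F[x, y]`; the variables are `x = X 0` and `y = X 1`. -/
abbrev PlanePoly (F : Type*) [CommRing F] : Type _ := MvPolynomial (Fin 2) F

section Tame

variable {F : Type*} [Field F]

/-- The Jacobian ideal `⟨∂g/∂x, ∂g/∂y⟩` of `F[x, y]`. -/
def jacobianIdeal (g : PlanePoly F) : Ideal (PlanePoly F) :=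
  Ideal.span {MvPolynomial.pderiv 0 g, MvPolynomial.pderiv 1 g}

/-- The Milnor vector space `F[x, y] / jacob(g)`. -/
abbrev MilnorSpace (g : PlanePoly F) : Type _ := PlanePoly F ⧸ jacobianIdeal g

/-- The last (highest degree) homogeneous piece of `f` for the weights
`deg x = α 0`, `deg y = α 1`. -/
def lastPiece (α : Fin 2 → ℕ) (f : PlanePoly F) : PlanePoly F :=
  MvPolynomial.weightedHomogeneousComponent α (MvPolynomial.weightedTotalDegree α f) f

/-- `f` is tame: for some positive integral weights of `x` and `y`, the last homogeneous piece
of `f` has a finite dimensional Milnor vector space. -/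
def IsTame (f : PlanePoly F) : Prop :=
  ∃ α : Fin 2 → ℕ, (∀ i, 0 < α i) ∧ FiniteDimensional F (MilnorSpace (lastPiece α f))

end Tame

section Singularities

variable {k : Type*} [Field k] [Algebra k ℂ]

/-- `p` is a singular point of the complex curve `f = 0` in `ℂ²`. -/
def IsSingularPoint (f : PlanePoly k) (p : Fin 2 → ℂ) : Prop :=
  MvPolynomial.aeval p f = 0 ∧ ∀ i, MvPolynomial.aeval p (MvPolynomial.pderiv i f) = 0

/-- The germ at `p` of the curve `F = 0` is quasi-homogeneous: there are holomorphic coordinates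
`u = (u 0, u 1)` on `(ℂ², p)`, centred at `p`, in which `F = a · g(u 0, u 1)` near `p`, with `a`
holomorphic, `a p ≠ 0`, and `g` a polynomial which is homogeneous of nonzero degree for some
integral weights of the two variables. -/
def IsQuasiHomogeneousGerm (F : (Fin 2 → ℂ) → ℂ) (p : Fin 2 → ℂ) : Prop :=
  ∃ (u : (Fin 2 → ℂ) → (Fin 2 → ℂ)) (a : (Fin 2 → ℂ) → ℂ) (g : MvPolynomial (Fin 2) ℂ)
    (α : Fin 2 → ℤ) (d : ℤ),
    AnalyticAt ℂ u p ∧ u p = 0 ∧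
    (∃ L : (Fin 2 → ℂ) ≃L[ℂ] (Fin 2 → ℂ), HasFDerivAt u (L : (Fin 2 → ℂ) →L[ℂ] (Fin 2 → ℂ)) p) ∧
    AnalyticAt ℂ a p ∧ a p ≠ 0 ∧
    d ≠ 0 ∧ MvPolynomial.IsWeightedHomogeneous α g d ∧
    ∀ᶠ z in nhds p, F z = a z * MvPolynomial.eval (u z) g

/-- All singularities of the curve `f = 0` are quasi-homogeneous. A smooth curve satisfies this,
having no singular point. -/
def HasOnlyQuasiHomogeneousSingularities (f : PlanePoly k) : Prop :=
  ∀ p : Fin 2 → ℂ, IsSingularPoint f p →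
    IsQuasiHomogeneousGerm (fun z => MvPolynomial.aeval z f) p

end Singularities

section Forms

variable {F : Type*} [Field F]

/-- The wedge product `ω₁ ∧ ω₂` of two polynomial 1-forms, linear in `ω₂`. -/
def wedge (ω₁ : Ω[PlanePoly F⁄F]) : Ω[PlanePoly F⁄F] →ₗ[PlanePoly F] ⋀[PlanePoly F]^2 (Ω[PlanePoly F⁄F]) where
  toFun ω₂ := exteriorPower.ιMulti (PlanePoly F) 2 ![ω₁, ω₂]
  map_add' a b := by
    have hu (c : Ω[PlanePoly F⁄F]) : Function.update ![ω₁, 0] 1 c = ![ω₁, c] := by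
      ext i; fin_cases i <;> rfl
    have h := (exteriorPower.ιMulti (PlanePoly F) 2 (M := Ω[PlanePoly F⁄F])).map_update_add ![ω₁, 0] 1 a b
    rwa [hu, hu, hu] at h
  map_smul' c a := by
    have hu (c : Ω[PlanePoly F⁄F]) : Function.update ![ω₁, 0] 1 c = ![ω₁, c] := by
      ext i; fin_cases i <;> rfl
    have h := (exteriorPower.ιMulti (PlanePoly F) 2 (M := Ω[PlanePoly F⁄F])).map_update_smul ![ω₁, 0] 1 c a
    rwa [hu, hu] at h

/-- The `F[x, y]`-module `E_f` of polynomial 1-forms `ω` with `df ∧ ω = f α` for some 2-form `α`,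
that is, of the 1-forms leaving the curve `f = 0` invariant. -/
def tangentForms (f : PlanePoly F) : Submodule (PlanePoly F) (Ω[PlanePoly F⁄F]) where
  carrier := {ω | ∃ α : ⋀[PlanePoly F]^2 (Ω[PlanePoly F⁄F]),
    wedge (KaehlerDifferential.D F (PlanePoly F) f) ω = f • α}
  zero_mem' := ⟨0, by simp⟩
  add_mem' := by
    rintro _ _ ⟨α, hα⟩ ⟨β, hβ⟩
    exact ⟨α + β, by rw [map_add, hα, hβ, smul_add]⟩
  smul_mem' := by
    rintro c _ ⟨α, hα⟩
    exact ⟨c • α, by rw [map_smul, hα, smul_comm]⟩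

/-- The `F[x, y]`-module of logarithmic vector fields along `f = 0`: the vector fields `θ` such
that `f` divides `θ(f)`. -/
def logVectorFields (f : PlanePoly F) : Submodule (PlanePoly F) (Derivation F (PlanePoly F) (PlanePoly F)) where
  carrier := {θ | f ∣ θ f}
  zero_mem' := by simp
  add_mem' h₁ h₂ := by simpa using dvd_add h₁ h₂
  smul_mem' c _ h := by simpa using Dvd.dvd.mul_left h c

/-- The curve `f = 0` in the affine plane over `F`, with `f` a reduced equation, is a free
divisor: its module of logarithmic vector fields is free. -/
def IsFreeDivisor (f : PlanePoly F) : Prop :=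
  Squarefree f ∧ Module.Free (PlanePoly F) (logVectorFields f)

end Forms

section Extension

variable (k K E : Type*) [Field k] [Field K] [Algebra k K]
  [AddCommGroup E] [Module k E] [Module (PlanePoly k) E] [IsScalarTower k (PlanePoly k) E]

/-- The tensor product `E ⊗_k K` of a `k[x, y]`-module `E` with an extension field `K` of `k`. -/
def ScalarExtension : Type _ := K ⊗[k] E

instance : AddCommGroup (ScalarExtension k K E) := inferInstanceAs (AddCommGroup (K ⊗[k] E))

/-- The action of `K[x, y] = K ⊗_k k[x, y]` on `K ⊗_k E`. -/
def extensionAction : PlanePoly K →ₐ[K] Module.End K (K ⊗[k] E) :=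
  (Algebra.TensorProduct.lift (Algebra.ofId K (Module.End K (K ⊗[k] E)))
    ((Module.End.baseChangeHom k K E).comp (Algebra.lsmul k k E))
    (fun c _ => Algebra.commutes c _)).comp
  (MvPolynomial.algebraTensorAlgEquiv (σ := Fin 2) k K).symm.toAlgHom

/-- `E ⊗_k K` is a `K[x, y]`-module. -/
instance : Module (PlanePoly K) (ScalarExtension k K E) :=
  Module.compHom (K ⊗[k] E) (extensionAction k K E).toRingHom

/-- The action is the expected one: `(c p) • (a ⊗ e) = (c a) ⊗ (p e)`, for `c, a ∈ K`,
`p ∈ k[x, y]` and `e ∈ E`. -/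
theorem extension_smul_tmul (c a : K) (p : PlanePoly k) (e : E) :
    ((c • MvPolynomial.map (algebraMap k K) p : PlanePoly K) •
      (show ScalarExtension k K E from a ⊗ₜ[k] e)) =
    (show ScalarExtension k K E from (c * a) ⊗ₜ[k] (p • e)) := by
  change extensionAction k K E (c • MvPolynomial.map (algebraMap k K) p) (a ⊗ₜ[k] e) =
    (c * a) ⊗ₜ[k] (p • e)
  rw [map_smul]
  simp only [extensionAction, AlgHom.comp_apply, AlgEquiv.coe_toAlgHom,
    MvPolynomial.algebraTensorAlgEquiv_symm_map]
  erw [Algebra.TensorProduct.lift_tmul]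
  rw [map_one, one_mul]
  rfl

end Extension

end TamePlaneCurve

end

/-!
The module `E_f` is `{P dx + Q dy : f ∣ f_x Q - f_y P}`, and the module of vector fields `θ` with
`f ∣ θ(f)` is `{A ∂_x + B ∂_y : f ∣ f_x A + f_y B}`. Both have the shape
`N = {w ∈ R² : f ∣ ℓ(w)}` with `R = F[x, y]` and `ℓ` a linear form (`formLattice`). Such a
submodule is free of rank two over any field `F` as soon as `f ≠ 0`. In terms of homological
algebra, `N` is a second syzygy over a ring of dimension two, hence projective, hence free by
Seshadri's theorem. The proof below is a direct version of Seshadri's argument and does not use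
projectivity.

Regard `R` as `A[X]` with `A = F[x]`, a principal ideal domain. Choose `u, v` in `N` whose
determinant `D` is nonzero, of the least possible degree, and with a leading coefficient minimal
for divisibility among those.

* Minimality of the degree: for `m` in `N`, Cramer's rule expresses `D m` through `u` and `v`, and
  the remainders of the coefficients in the pseudo-division by `D` are again determinants of pairs
  of vectors of `N`, of smaller degree, so that they vanish. Thus `c m` lies in `⟨u, v⟩` for some
  nonzero `c` in `A`.
* Minimality of the leading coefficient: suppose that `p m = a u + b v`, with `p` a prime of `A`
  not dividing both `a` and `b`. As `(A ⧸ p)[X]` is Euclidean, a matrix of determinant one over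
  `A[X]` brings the relation to `p m' = d u'` with `p ∤ d`. Then `u' = p n`, and both `p n` and
  `d n = m'` lie in `N`. As `p` and `d` have no common factor, `f ∣ p ℓ(n)` and `f ∣ d ℓ(n)` give
  `f ∣ ℓ(n)`, so `n` is in `N`; replacing `u'` by `n` divides `D` by `p`, a contradiction. The
  primes of `c` can therefore be cancelled one at a time.

These steps are `exists_pair_generating_of_saturated` and `dvd_of_dvd_prime_mul`. A basis of `E_f`
over `k[x, y]` remains one after extension of scalars (`ScalarExtension.basis`), so that `K = k`
is a possible choice of the finite extension.

Tameness gives `f ≠ 0` and square-freeness (`IsTame.squarefree_map`). The top weighted piece is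
multiplicative, so if `a²` divides `f`, the top piece `t` of `a` divides both partial derivatives
of the top piece of `f`. The ideal they generate has finite codimension, hence contains nonzero
polynomials in `x` alone and in `y` alone. As `t` divides both, it is constant, and so is `a`, the
weights being positive.
-/

noncomputable section

namespace TamePlaneCurve

/-! ### Seshadri's theorem in rank two -/

section Seshadri

/-- Row reduction over a Euclidean domain, lifted along a surjection: some element
`!![p, q; r, s]` of `SL₂(R)` makes the second entry of the pair `(a, b)` vanish in `S`. -/
theorem exists_unimodular_reduction {R S : Type*} [CommRing R] [EuclideanDomain S] (π : R →+* S)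
    (hπ : Function.Surjective π) (a b : R) :
    ∃ p q r s : R, p * s - q * r = 1 ∧ π (r * a + s * b) = 0 := by
  suffices H : ∀ (y : S) (a b : R), π b = y →
      ∃ p q r s : R, p * s - q * r = 1 ∧ π (r * a + s * b) = 0 from H _ a b rfl
  intro y
  refine EuclideanDomain.r_wellFounded.induction (C := fun y => ∀ (a b : R), π b = y →
      ∃ p q r s : R, p * s - q * r = 1 ∧ π (r * a + s * b) = 0) y ?_
  intro y ih a b hb
  by_cases hy : y = 0
  · exact ⟨1, 0, 0, 1, by ring, by simp [hb, hy]⟩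
  · obtain ⟨t, ht⟩ := hπ (π a / y)
    have hrem : π (a - t * b) = π a % y := by
      rw [EuclideanDomain.mod_eq_sub_mul_div, map_sub, map_mul, ht, hb, mul_comm]
    obtain ⟨p, q, r, s, hdet, h0⟩ :=
      ih (π a % y) (EuclideanDomain.mod_lt _ hy) (-b) (a - t * b) hrem
    refine ⟨q, -p - q * t, s, -r - s * t, by linear_combination hdet, ?_⟩
    rw [← h0]
    congr 1
    ring

/-- The determinant of a pair of vectors of a free module of rank two. -/
def pairDet {R : Type*} [CommRing R] (u v : R × R) : R := u.1 * v.2 - u.2 * v.1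

open Polynomial

variable {A : Type*} [CommRing A] [IsDomain A]

/-- Pseudo-division: division with remainder after multiplication of the dividend by a nonzero
constant. -/
theorem exists_pseudo_division (a : A[X]) {d : A[X]} (hd : d ≠ 0) :
    ∃ (c : A) (q r : A[X]), c ≠ 0 ∧ C c * a = q * d + r ∧ r.degree < d.degree := by
  induction hn : a.degree using WellFoundedLT.induction generalizing a with
  | _ n ih =>
  subst hn
  by_cases ha : a.degree < d.degree
  · exact ⟨1, 0, a, one_ne_zero, by simp, ha⟩
  push Not at ha
  have ha0 : a ≠ 0 := by
    rintro rfl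
    exact hd (by simpa using ha)
  have hla := leadingCoeff_ne_zero.mpr ha0
  have hld := leadingCoeff_ne_zero.mpr hd
  have hle : d.natDegree ≤ a.natDegree := natDegree_le_natDegree ha
  have hlt : (C d.leadingCoeff * a -
      C a.leadingCoeff * X ^ (a.natDegree - d.natDegree) * d).degree < a.degree := by
    have h1 : (C d.leadingCoeff * a).degree = a.degree := degree_C_mul hld
    rw [← h1]
    refine degree_sub_lt_left ?_ (mul_ne_zero (by simpa using hld) ha0) ?_
    · rw [h1, mul_assoc, degree_C_mul hla, degree_mul, degree_X_pow, degree_eq_natDegree ha0,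
        degree_eq_natDegree hd]
      norm_cast
      omega
    · simp only [leadingCoeff_mul, leadingCoeff_C, leadingCoeff_X_pow]
      ring
  obtain ⟨c, q, r, hc, heq, hr⟩ := ih _ hlt _ rfl
  exact ⟨c * d.leadingCoeff, q + C c * C a.leadingCoeff * X ^ (a.natDegree - d.natDegree), r,
    mul_ne_zero hc hld, by rw [C_mul]; linear_combination heq, hr⟩

variable [IsPrincipalIdealRing A]

/-- Row reduction modulo a prime `p` of `A`, by matrices over `A[X]`: `(A ⧸ p)[X]` is Euclidean. -/
theorem exists_unimodular_reduction_mod_prime {p : A} (hp : Prime p) (a b : A[X]) :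
    ∃ s t r w : A[X], s * w - t * r = 1 ∧ C p ∣ r * a + w * b := by
  have hmax : (Ideal.span {p}).IsMaximal :=
    PrincipalIdealRing.isMaximal_of_irreducible hp.irreducible
  let : Field (A ⧸ Ideal.span {p}) := Ideal.Quotient.field _
  obtain ⟨s, t, r, w, hdet, h0⟩ := exists_unimodular_reduction
    (mapRingHom (Ideal.Quotient.mk (Ideal.span {p})))
    (map_surjective _ Ideal.Quotient.mk_surjective) a b
  refine ⟨s, t, r, w, hdet, ?_⟩
  rw [C_dvd_iff_dvd_coeff]
  intro i
  rw [← Ideal.Quotient.eq_zero_iff_dvd, ← coeff_map]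
  have := congrArg (fun q : (A ⧸ Ideal.span {p})[X] => q.coeff i) h0
  simpa using this

/-- Seshadri's theorem in rank two: a submodule of `A[X]²` of full rank over a principal ideal
domain `A` is generated by two independent vectors, if it contains every vector `n` with both
`p n` and `d n` in it, for `p` a prime of `A` and `d` prime to `p`.

Among the pairs with nonzero determinant, one whose determinant has least degree, and then a
leading coefficient minimal for divisibility, is a basis. -/
theorem exists_pair_generating_of_saturated (N : Submodule A[X] (A[X] × A[X]))
    (hrank : ∃ u ∈ N, ∃ v ∈ N, pairDet u v ≠ 0)
    (hsat : ∀ (p : A) (d : A[X]) (n : A[X] × A[X]), Prime p → ¬ C p ∣ d →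
      C p • n ∈ N → d • n ∈ N → n ∈ N) :
    ∃ u ∈ N, ∃ v ∈ N, pairDet u v ≠ 0 ∧ ∀ m ∈ N, ∃ a b : A[X], m = a • u + b • v := by
  classical
  have hex : ∃ n : ℕ, ∃ u ∈ N, ∃ v ∈ N, pairDet u v ≠ 0 ∧ (pairDet u v).natDegree = n := by
    obtain ⟨u, hu, v, hv, h⟩ := hrank
    exact ⟨_, u, hu, v, hv, h, rfl⟩
  set n₀ := Nat.find hex with hn₀
  obtain ⟨l, ⟨u, hu, v, hv, h0, hdeg, rfl⟩, hmin⟩ :=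
    (wellFounded_dvdNotUnit (α := A)).has_min
      {l : A | ∃ u ∈ N, ∃ v ∈ N, pairDet u v ≠ 0 ∧ (pairDet u v).natDegree = n₀ ∧
        (pairDet u v).leadingCoeff = l}
      (by
        obtain ⟨u, hu, v, hv, h, hd⟩ := Nat.find_spec hex
        exact ⟨_, u, hu, v, hv, h, hd, rfl⟩)
  have hmindeg : ∀ u' ∈ N, ∀ v' ∈ N, (pairDet u' v').degree < (pairDet u v).degree →
      pairDet u' v' = 0 := by
    intro u' hu' v' hv' hlt
    by_contra hne
    refine Nat.find_min hex (m := (pairDet u' v').natDegree) ?_ ⟨u', hu', v', hv', hne, rfl⟩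
    rw [← hn₀, ← hdeg]
    exact natDegree_lt_natDegree hne hlt
  refine ⟨u, hu, v, hv, h0, ?_⟩
  -- Minimality of the leading coefficient: a prime of `A` can be cancelled.
  have hprime : ∀ p : A, Prime p → ∀ m ∈ N, ∀ a b : A[X], C p • m = a • u + b • v →
      ∃ a' b' : A[X], m = a' • u + b' • v := by
    intro p hp m hm a b hmab
    have hCp : Prime (C p : A[X]) := prime_C_iff.mpr hp
    obtain ⟨s, t, r, w, hdet, e, he⟩ := exists_unimodular_reduction_mod_prime hp a b
    by_cases hd : C p ∣ s * a + t * b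
    · obtain ⟨g, hg⟩ := hd
      have ha : a = C p * (w * g - t * e) := by
        linear_combination (-a) * hdet + w * hg - t * he
      have hb : b = C p * (s * e - r * g) := by
        linear_combination (-b) * hdet + s * he - r * hg
      refine ⟨w * g - t * e, s * e - r * g, smul_right_injective _ hCp.ne_zero ?_⟩
      simp only
      rw [hmab, smul_add, smul_smul, smul_smul, ← ha, ← hb]
    · -- In the reduced basis `(u', v')` the relation says that `(s a + t b) u'` is divisible by
      -- `p`. So `u' / p` is a vector, which lies in `N` by saturation, and replacing `u'` by it
      -- divides the determinant by `p`.
      exfalso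
      set u' := w • u - r • v with hu'
      set v' := s • v - t • u with hv'
      have hu'N : u' ∈ N := N.sub_mem (N.smul_mem _ hu) (N.smul_mem _ hv)
      have hv'N : v' ∈ N := N.sub_mem (N.smul_mem _ hv) (N.smul_mem _ hu)
      have hdet' : pairDet u' v' = pairDet u v := by
        simp only [pairDet, hu', hv', Prod.fst_sub, Prod.snd_sub, Prod.smul_fst, Prod.smul_snd,
          smul_eq_mul]
        linear_combination (u.1 * v.2 - u.2 * v.1) * hdet
      have hm' : C p • (m - e • v') = (s * a + t * b) • u' := by
        rw [smul_sub, hmab, smul_smul, ← he, hu', hv']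
        ext1 <;> simp only [Prod.fst_sub, Prod.snd_sub, Prod.fst_add, Prod.snd_add,
          Prod.smul_fst, Prod.smul_snd, smul_eq_mul]
        · linear_combination (-(a * u.1 + b * v.1)) * hdet
        · linear_combination (-(a * u.2 + b * v.2)) * hdet
      have hdvd1 : C p ∣ u'.1 := by
        refine (hCp.dvd_or_dvd ⟨(m - e • v').1, ?_⟩).resolve_left hd
        exact (congrArg Prod.fst hm').symm
      have hdvd2 : C p ∣ u'.2 := by
        refine (hCp.dvd_or_dvd ⟨(m - e • v').2, ?_⟩).resolve_left hd
        exact (congrArg Prod.snd hm').symm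
      obtain ⟨n1, hn1⟩ := hdvd1
      obtain ⟨n2, hn2⟩ := hdvd2
      have hn : C p • ((n1, n2) : A[X] × A[X]) = u' := Prod.ext hn1.symm hn2.symm
      have hdn : (s * a + t * b) • ((n1, n2) : A[X] × A[X]) = m - e • v' := by
        refine smul_right_injective _ hCp.ne_zero ?_
        simp only
        rw [hm', ← hn, smul_comm]
      have hnN : ((n1, n2) : A[X] × A[X]) ∈ N :=
        hsat p _ _ hp hd (hn ▸ hu'N) (hdn ▸ N.sub_mem hm (N.smul_mem _ hv'N))
      have hD : C p * pairDet (n1, n2) v' = pairDet u v := by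
        rw [← hdet']
        simp only [pairDet, hn1, hn2]
        ring
      have hD0 : pairDet (n1, n2) v' ≠ 0 := by
        intro h
        rw [h, mul_zero] at hD
        exact h0 hD.symm
      refine hmin _ ⟨_, hnN, v', hv'N, hD0, ?_, rfl⟩ ⟨?_, p, hp.not_isUnit, ?_⟩
      · rw [← hdeg, ← hD, natDegree_C_mul hp.ne_zero]
      · exact leadingCoeff_ne_zero.mpr hD0
      · rw [← hD, leadingCoeff_mul, leadingCoeff_C, mul_comm]
  have hcancel : ∀ c : A, c ≠ 0 → ∀ m ∈ N, ∀ a b : A[X], C c • m = a • u + b • v →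
      ∃ a' b' : A[X], m = a' • u + b' • v := by
    intro c
    induction c using WfDvdMonoid.induction_on_irreducible with
    | zero => exact fun h => absurd rfl h
    | unit c hc =>
      intro _ m _ a b h
      obtain ⟨c', hc'⟩ := hc.exists_left_inv
      refine ⟨C c' * a, C c' * b, ?_⟩
      rw [mul_smul, mul_smul, ← smul_add, ← h, smul_smul, ← C_mul, hc', C_1, one_smul]
    | mul c i hc hi ih =>
      intro _ m hm a b h
      rw [C_mul, mul_smul] at h
      obtain ⟨a', b', h'⟩ := hprime i hi.prime _ (N.smul_mem _ hm) a b h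
      exact ih hc m hm a' b' h'
  -- Minimality of the degree: `pairDet u v` divides the Cramer numerators over `Frac A`.
  have hdiv : ∀ x : A[X], (∀ c q : A[X], ∃ u' ∈ N, ∃ v' ∈ N,
      pairDet u' v' = c * x - q * pairDet u v) →
      ∃ (c : A) (q : A[X]), c ≠ 0 ∧ C c * x = q * pairDet u v := by
    intro x hx
    obtain ⟨c, q, r, hc, heq, hr⟩ := exists_pseudo_division x h0
    obtain ⟨u', hu', v', hv', h⟩ := hx (C c) q
    rw [heq, add_sub_cancel_left] at h
    have hr0 := hmindeg u' hu' v' hv' (h ▸ hr)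
    exact ⟨c, q, hc, by rw [heq, ← h, hr0, add_zero]⟩
  intro m hm
  obtain ⟨c₁, q₁, hc₁, hq₁⟩ := hdiv (pairDet m v) fun c q =>
    ⟨c • m - q • u, N.sub_mem (N.smul_mem _ hm) (N.smul_mem _ hu), v, hv, by
      simp [pairDet]; ring⟩
  obtain ⟨c₂, q₂, hc₂, hq₂⟩ := hdiv (pairDet u m) fun c q =>
    ⟨u, hu, c • m - q • v, N.sub_mem (N.smul_mem _ hm) (N.smul_mem _ hv), by
      simp [pairDet]; ring⟩
  refine hcancel (c₁ * c₂) (mul_ne_zero hc₁ hc₂) m hm (C c₂ * q₁) (C c₁ * q₂) ?_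
  refine smul_right_injective _ h0 ?_
  simp only [pairDet] at hq₁ hq₂
  ext1 <;> simp only [pairDet, C_mul, Prod.fst_add, Prod.snd_add, Prod.smul_fst, Prod.smul_snd,
    smul_eq_mul]
  · linear_combination C c₂ * u.1 * hq₁ + C c₁ * v.1 * hq₂
  · linear_combination C c₂ * u.2 * hq₁ + C c₁ * v.2 * hq₂

end Seshadri

/-! ### Vectors on which a linear form is divisible by a polynomial -/

section Lattice
open Polynomial

/-- `R / f` has no nonzero element killed by both `p` and `d`, for `p` prime and `p ∤ d`. -/
theorem dvd_of_dvd_prime_mul {R : Type*} [CommRing R] [IsDomain R] {p f d x : R} (hp : Prime p)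
    (hpd : ¬ p ∣ d) (h₁ : f ∣ p * x) (h₂ : f ∣ d * x) : f ∣ x := by
  obtain ⟨y, hy⟩ := h₁
  have hpy : p ∣ y → f ∣ x := by
    rintro ⟨z, rfl⟩
    exact ⟨z, mul_left_cancel₀ hp.ne_zero (by rw [hy]; ring)⟩
  refine (hp.dvd_or_dvd ⟨x, hy.symm⟩).elim ?_ hpy
  rintro ⟨g, rfl⟩
  have hx : x = g * y := mul_left_cancel₀ hp.ne_zero (by rw [hy]; ring)
  obtain ⟨z, hz⟩ := h₂
  by_cases hg : g = 0
  · simp [hx, hg]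
  refine hpy ((hp.dvd_or_dvd ⟨z, ?_⟩).resolve_left hpd)
  refine mul_left_cancel₀ hg ?_
  linear_combination hz - d * hx

/-- The vectors on which the linear form `(x, y) ↦ a x + b y` is divisible by `f`. -/
def formLattice {R : Type*} [CommRing R] (f a b : R) : Submodule R (R × R) where
  carrier := {w | f ∣ a * w.1 + b * w.2}
  zero_mem' := by simp
  add_mem' {v w} hv hw := by
    have := dvd_add hv hw
    simp only [Set.mem_ofPred_eq, Prod.fst_add, Prod.snd_add]
    convert this using 1
    ring
  smul_mem' c w hw := by
    have := Dvd.dvd.mul_left hw c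
    simp only [Set.mem_ofPred_eq, Prod.smul_fst, Prod.smul_snd, smul_eq_mul]
    convert this using 1
    ring

theorem mem_formLattice {R : Type*} [CommRing R] {f a b : R} {w : R × R} :
    w ∈ formLattice f a b ↔ f ∣ a * w.1 + b * w.2 := Iff.rfl

theorem exists_pair_generating_formLattice_polynomial {A : Type*} [CommRing A] [IsDomain A]
    [IsPrincipalIdealRing A] {f : A[X]} (hf : f ≠ 0) (a b : A[X]) :
    ∃ u ∈ formLattice f a b, ∃ v ∈ formLattice f a b, pairDet u v ≠ 0 ∧
      ∀ m ∈ formLattice f a b, ∃ c d : A[X], m = c • u + d • v := by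
  -- The lattice has full rank because it contains `f R²`.
  refine exists_pair_generating_of_saturated _ ⟨(f, 0), ?_, (0, f), ?_, ?_⟩ ?_
  · simp [mem_formLattice]
  · simp [mem_formLattice]
  · simp [pairDet, hf]
  · intro p d n hp hpd h₁ h₂
    rw [mem_formLattice] at h₁ h₂ ⊢
    refine dvd_of_dvd_prime_mul (prime_C_iff.mpr hp) hpd ?_ ?_
    · convert h₁ using 1
      simp only [Prod.smul_fst, Prod.smul_snd, smul_eq_mul]
      ring
    · convert h₂ using 1
      simp only [Prod.smul_fst, Prod.smul_snd, smul_eq_mul]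
      ring

/-- The case of two variables, through `F[x, y] ≃ F[X][X]`. -/
theorem exists_pair_generating_formLattice {F : Type*} [Field F] {f : PlanePoly F} (hf : f ≠ 0)
    (a b : PlanePoly F) :
    ∃ u ∈ formLattice f a b, ∃ v ∈ formLattice f a b, pairDet u v ≠ 0 ∧
      ∀ m ∈ formLattice f a b, ∃ c d : PlanePoly F, m = c • u + d • v := by
  let e : PlanePoly F ≃ₐ[F] F[X][X] :=
    (MvPolynomial.finSuccEquiv F 1).trans (Polynomial.mapAlgEquiv (MvPolynomial.uniqueAlgEquiv F _))
  have hmem : ∀ w : F[X][X] × F[X][X], w ∈ formLattice (e f) (e a) (e b) →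
      (e.symm w.1, e.symm w.2) ∈ formLattice f a b := by
    intro w hw
    have := map_dvd e.symm (mem_formLattice.mp hw)
    simpa [mem_formLattice] using this
  obtain ⟨u, hu, v, hv, h0, hgen⟩ := exists_pair_generating_formLattice_polynomial
    (f := e f) (by simpa using hf) (e a) (e b)
  refine ⟨_, hmem u hu, _, hmem v hv, ?_, ?_⟩
  · intro h
    refine h0 (e.symm.injective ?_)
    simpa [pairDet] using h
  · intro m hm
    have hm' : (e m.1, e m.2) ∈ formLattice (e f) (e a) (e b) := by
      have := map_dvd e (mem_formLattice.mp hm)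
      simpa [mem_formLattice] using this
    obtain ⟨c, d, hcd⟩ := hgen _ hm'
    refine ⟨e.symm c, e.symm d, Prod.ext ?_ ?_⟩
    · have := congrArg (fun z => e.symm z.1) hcd
      simpa using this
    · have := congrArg (fun z => e.symm z.2) hcd
      simpa using this

/-- A submodule of a free `F[x, y]`-module of rank two, cut out by the divisibility by `f ≠ 0` of
a linear form, is free of rank two. -/
theorem nonempty_basis_of_mem_iff_dvd {F : Type*} [Field F] {f : PlanePoly F} (hf : f ≠ 0)
    (a b : PlanePoly F) {M : Type*} [AddCommGroup M] [Module (PlanePoly F) M]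
    (B : Module.Basis (Fin 2) (PlanePoly F) M) (S : Submodule (PlanePoly F) M)
    (hS : ∀ m, m ∈ S ↔ f ∣ a * B.repr m 0 + b * B.repr m 1) :
    Nonempty (Module.Basis (Fin 2) (PlanePoly F) S) := by
  obtain ⟨u, hu, v, hv, h0, hgen⟩ := exists_pair_generating_formLattice hf a b
  have hmk : ∀ w ∈ formLattice f a b, w.1 • B 0 + w.2 • B 1 ∈ S := by
    intro w hw
    rw [hS]
    simpa [Finsupp.single_apply, mem_formLattice] using hw
  let s : Fin 2 → S := ![⟨_, hmk u hu⟩, ⟨_, hmk v hv⟩]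
  refine ⟨Module.Basis.mk (v := s) ?_ ?_⟩
  · rw [LinearIndependent.pair_iff]
    intro c d hcd
    have hcd' := congrArg (fun z : S => B.repr (z : M)) hcd
    have e0 : c * u.1 + d * v.1 = 0 := by
      simpa [s, Finsupp.single_apply] using DFunLike.congr_fun hcd' 0
    have e1 : c * u.2 + d * v.2 = 0 := by
      simpa [s, Finsupp.single_apply] using DFunLike.congr_fun hcd' 1
    constructor
    · refine (mul_eq_zero.mp ?_).resolve_right h0
      simp only [pairDet]
      linear_combination v.2 * e0 - v.1 * e1
    · refine (mul_eq_zero.mp ?_).resolve_right h0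
      simp only [pairDet]
      linear_combination u.1 * e1 - u.2 * e0
  · rintro ⟨m, hm⟩ -
    obtain ⟨c, d, hcd⟩ := hgen (B.repr m 0, B.repr m 1) (mem_formLattice.mpr ((hS m).mp hm))
    have : (⟨m, hm⟩ : S) = c • s 0 + d • s 1 := by
      apply Subtype.ext
      apply B.repr.injective
      refine Finsupp.ext fun i => ?_
      fin_cases i
      · simpa [s, Finsupp.single_apply] using congrArg Prod.fst hcd
      · simpa [s, Finsupp.single_apply] using congrArg Prod.snd hcd
    rw [this]
    exact add_mem (Submodule.smul_mem _ _ (Submodule.subset_span ⟨0, rfl⟩))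
      (Submodule.smul_mem _ _ (Submodule.subset_span ⟨1, rfl⟩))

end Lattice

/-! ### Tangent forms, logarithmic vector fields and scalar extension -/

section Forms

variable {F : Type*} [Field F]

theorem ιMulti_eq_det_smul {R M : Type*} [CommRing R] [AddCommGroup M] [Module R M] {n : ℕ}
    (B : Module.Basis (Fin n) R M) (v : Fin n → M) :
    exteriorPower.ιMulti R n v = B.det v • exteriorPower.ιMulti R n B := by
  have h : exteriorPower.ιMulti R n (M := M) =
      (LinearMap.toSpanSingleton R _ (exteriorPower.ιMulti R n B)).compAlternatingMap B.det := by
    refine Module.Basis.ext_alternating B fun w hw => ?_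
    let σ : Equiv.Perm (Fin n) := Equiv.ofBijective w (Finite.injective_iff_bijective.mp hw)
    have hσ : (fun i => B (w i)) = B ∘ σ := rfl
    rw [hσ]
    simp [AlternatingMap.map_perm, Module.Basis.det_self]
  rw [h]
  simp [Module.Basis.det_self]

open KaehlerDifferential in
/-- In the basis `dx, dy`, the form `df ∧ ω` is a determinant times `dx ∧ dy`, so membership in
`tangentForms f` is the divisibility of that determinant by `f`. -/
theorem mem_tangentForms_iff_dvd (f : PlanePoly F) (ω : Ω[PlanePoly F⁄F]) :
    ω ∈ tangentForms f ↔
      f ∣ (-MvPolynomial.pderiv 1 f) * (mvPolynomialBasis F (Fin 2)).repr ω 0 +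
        MvPolynomial.pderiv 0 f * (mvPolynomialBasis F (Fin 2)).repr ω 1 := by
  set B := mvPolynomialBasis F (Fin 2) with hB
  have hdet : B.det ![D F (PlanePoly F) f, ω] =
      (-MvPolynomial.pderiv 1 f) * B.repr ω 0 + MvPolynomial.pderiv 0 f * B.repr ω 1 := by
    rw [Module.Basis.det_apply, Matrix.det_fin_two]
    simp [Module.Basis.toMatrix_apply, hB, mvPolynomialBasis_repr_apply]
    ring
  rw [← hdet]
  constructor
  · rintro ⟨α, hα⟩
    have := congrArg (exteriorPower.alternatingMapLinearEquiv B.det) hα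
    rw [map_smul] at this
    refine ⟨_, Eq.trans ?_ this⟩
    exact (exteriorPower.alternatingMapLinearEquiv_apply_ιMulti _ _).symm
  · rintro ⟨c, hc⟩
    refine ⟨c • exteriorPower.ιMulti _ 2 B, ?_⟩
    rw [smul_smul, ← hc]
    exact ιMulti_eq_det_smul B _

/-- The partial derivatives, as a basis of the module of polynomial vector fields. -/
def derivationBasis (F : Type*) [Field F] :
    Module.Basis (Fin 2) (PlanePoly F) (Derivation F (PlanePoly F) (PlanePoly F)) :=
  Module.Basis.ofEquivFun
    { (MvPolynomial.mkDerivationEquiv F (σ := Fin 2) (A := PlanePoly F)).symm with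
      map_smul' := fun _ _ => rfl }

theorem derivationBasis_repr (θ : Derivation F (PlanePoly F) (PlanePoly F)) (i : Fin 2) :
    (derivationBasis F).repr θ i = θ (MvPolynomial.X i) := rfl

theorem derivation_apply_eq (θ : Derivation F (PlanePoly F) (PlanePoly F)) (f : PlanePoly F) :
    θ f = MvPolynomial.pderiv 0 f * θ (MvPolynomial.X 0) +
      MvPolynomial.pderiv 1 f * θ (MvPolynomial.X 1) := by
  have h : θ = θ (MvPolynomial.X 0) • MvPolynomial.pderiv 0 +
      θ (MvPolynomial.X 1) • MvPolynomial.pderiv 1 := by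
    refine MvPolynomial.derivation_ext fun i => ?_
    fin_cases i <;> simp [MvPolynomial.pderiv_X]
  have := DFunLike.congr_fun h f
  rw [this]
  simp [mul_comm]

theorem nonempty_basis_tangentForms {f : PlanePoly F} (hf : f ≠ 0) :
    Nonempty (Module.Basis (Fin 2) (PlanePoly F) (tangentForms f)) :=
  nonempty_basis_of_mem_iff_dvd hf _ _ _ _ (mem_tangentForms_iff_dvd f)

theorem nonempty_basis_logVectorFields {f : PlanePoly F} (hf : f ≠ 0) :
    Nonempty (Module.Basis (Fin 2) (PlanePoly F) (logVectorFields f)) := by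
  refine nonempty_basis_of_mem_iff_dvd hf (MvPolynomial.pderiv 0 f) (MvPolynomial.pderiv 1 f)
    (derivationBasis F) _ fun θ => ?_
  rw [derivationBasis_repr, derivationBasis_repr, ← derivation_apply_eq]
  rfl

end Forms

section Extension

variable {k K E ι : Type*} [Field k] [Field K] [Algebra k K]
  [AddCommGroup E] [Module k E] [Module (PlanePoly k) E] [IsScalarTower k (PlanePoly k) E]

/-- An additive property of polynomials over `K` may be checked on the multiples `c p` of the
polynomials `p` over `k` by constants `c` of `K`. -/
theorem PlanePoly.induction_smul_map {P : PlanePoly K → Prop}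
    (hadd : ∀ p q, P p → P q → P (p + q))
    (hmap : ∀ (c : K) (p : PlanePoly k), P (c • MvPolynomial.map (algebraMap k K) p))
    (p : PlanePoly K) : P p := by
  induction p using MvPolynomial.induction_on' with
  | monomial d a =>
    have := hmap a (MvPolynomial.monomial d 1)
    simpa [MvPolynomial.smul_monomial] using this
  | add p q hp hq => exact hadd p q hp hq

variable [Fintype ι] [DecidableEq ι]

/-- The coordinates on `K ⊗_k E` deduced from a `k[x, y]`-basis of `E`. -/
def extensionCoord (K : Type*) [Field K] [Algebra k K] (b : Module.Basis ι (PlanePoly k) E) :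
    K ⊗[k] E ≃ₗ[K] (ι → PlanePoly K) :=
  (LinearEquiv.baseChange k K _ _ (b.equivFun.restrictScalars k)).trans
    ((TensorProduct.piRight k K K (fun _ : ι => PlanePoly k)).trans
      (LinearEquiv.piCongrRight fun _ =>
        (MvPolynomial.algebraTensorAlgEquiv (σ := Fin 2) k K).toLinearEquiv))

theorem extensionCoord_tmul (b : Module.Basis ι (PlanePoly k) E) (a : K) (e : E) (i : ι) :
    extensionCoord K b (a ⊗ₜ[k] e) i =
      a • MvPolynomial.map (algebraMap k K) (b.equivFun e i) := by
  simp [extensionCoord]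

theorem extensionAction_tmul (c a : K) (p : PlanePoly k) (e : E) :
    extensionAction k K E (c • MvPolynomial.map (algebraMap k K) p) (a ⊗ₜ[k] e) =
      (c * a) ⊗ₜ[k] (p • e) :=
  extension_smul_tmul k K E c a p e

theorem extensionCoord_extensionAction (b : Module.Basis ι (PlanePoly k) E) (p : PlanePoly K)
    (t : K ⊗[k] E) :
    extensionCoord K b (extensionAction k K E p t) = p • extensionCoord K b t := by
  refine PlanePoly.induction_smul_map (k := k)
    (P := fun p => extensionCoord K b (extensionAction k K E p t) = p • extensionCoord K b t)
    ?_ ?_ p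
  · intro p q hp hq
    rw [map_add, LinearMap.add_apply, map_add, hp, hq, add_smul]
  · intro c p
    induction t with
    | zero => simp only [map_zero, smul_zero]
    | tmul a e =>
      rw [extensionAction_tmul]
      funext i
      rw [Pi.smul_apply, extensionCoord_tmul, extensionCoord_tmul, map_smul, Pi.smul_apply]
      simp only [smul_eq_mul, map_mul, MvPolynomial.smul_eq_C_mul]
      ring
    | add x y hx hy => rw [map_add, map_add, map_add, hx, hy, smul_add]

/-- A `k[x, y]`-basis of `E` gives a `K[x, y]`-basis of `E ⊗_k K`. -/
def ScalarExtension.basis (K : Type*) [Field K] [Algebra k K]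
    (b : Module.Basis ι (PlanePoly k) E) :
    Module.Basis ι (PlanePoly K) (ScalarExtension k K E) :=
  Module.Basis.ofEquivFun
    { (extensionCoord K b).toAddEquiv with
      map_smul' := extensionCoord_extensionAction b }

end Extension

/-! ### Square-freeness of tame polynomials -/

section Squarefree

open MvPolynomial

variable {σ R : Type*} [CommRing R]

theorem weight_le_weightedTotalDegree_of_coeff_ne_zero (w : σ → ℕ) {p : MvPolynomial σ R}
    {d : σ →₀ ℕ} (hd : coeff d p ≠ 0) : Finsupp.weight w d ≤ weightedTotalDegree w p :=
  le_weightedTotalDegree w (mem_support_iff.mpr hd)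

/-- If `m` and `n` bound the weighted degrees of `p` and `q`, the component of degree `m + n` of
`p * q` is the product of the components of degrees `m` and `n`. -/
theorem weightedHomogeneousComponent_add_mul (w : σ → ℕ) {p q : MvPolynomial σ R} {m n : ℕ}
    (hp : weightedTotalDegree w p ≤ m) (hq : weightedTotalDegree w q ≤ n) :
    weightedHomogeneousComponent w (m + n) (p * q) =
      weightedHomogeneousComponent w m p * weightedHomogeneousComponent w n q := by
  classical
  ext d
  rw [coeff_weightedHomogeneousComponent, coeff_mul, coeff_mul]
  have key : ∀ x ∈ Finset.HasAntidiagonal.antidiagonal d,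
      coeff x.1 (weightedHomogeneousComponent w m p) *
        coeff x.2 (weightedHomogeneousComponent w n q) =
      if Finsupp.weight w d = m + n then coeff x.1 p * coeff x.2 q else 0 := by
    rintro ⟨i, j⟩ hij
    have hw : Finsupp.weight w d = Finsupp.weight w i + Finsupp.weight w j := by
      rw [← Finset.HasAntidiagonal.mem_antidiagonal.mp hij, map_add]
    simp only [coeff_weightedHomogeneousComponent]
    by_cases hi : coeff i p = 0
    · simp [hi]
    by_cases hj : coeff j q = 0
    · simp [hj]
    have h1 := (weight_le_weightedTotalDegree_of_coeff_ne_zero w hi).trans hp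
    have h2 := (weight_le_weightedTotalDegree_of_coeff_ne_zero w hj).trans hq
    rw [hw]
    by_cases h3 : Finsupp.weight w i = m
    · by_cases h4 : Finsupp.weight w j = n
      · simp [h3, h4]
      · have h5 : Finsupp.weight w i + Finsupp.weight w j ≠ m + n := by omega
        rw [if_neg h4, if_neg h5, mul_zero]
    · have h5 : Finsupp.weight w i + Finsupp.weight w j ≠ m + n := by omega
      rw [if_neg h3, if_neg h5, zero_mul]
  rw [Finset.sum_congr rfl key]
  split_ifs <;> simp

theorem weightedTotalDegree_mul_le (w : σ → ℕ) (p q : MvPolynomial σ R) :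
    weightedTotalDegree w (p * q) ≤ weightedTotalDegree w p + weightedTotalDegree w q := by
  classical
  refine Finset.sup_le fun d hd => ?_
  obtain ⟨⟨i, j⟩, hij, hne⟩ := Finset.exists_ne_zero_of_sum_ne_zero
    (coeff_mul p q d ▸ mem_support_iff.mp hd)
  rw [← Finset.HasAntidiagonal.mem_antidiagonal.mp hij, map_add]
  exact add_le_add
    (weight_le_weightedTotalDegree_of_coeff_ne_zero w (left_ne_zero_of_mul hne))
    (weight_le_weightedTotalDegree_of_coeff_ne_zero w (right_ne_zero_of_mul hne))

theorem weightedHomogeneousComponent_weightedTotalDegree_ne_zero (w : σ → ℕ)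
    {p : MvPolynomial σ R} (hp : p ≠ 0) :
    weightedHomogeneousComponent w (weightedTotalDegree w p) p ≠ 0 := by
  classical
  obtain ⟨d, hd, heq⟩ := Finset.exists_mem_eq_sup p.support (support_nonempty.mpr hp)
    (fun s => Finsupp.weight w s)
  intro h
  have h' := congrArg (coeff d) h
  rw [coeff_weightedHomogeneousComponent, coeff_zero] at h'
  exact mem_support_iff.mp hd ((if_pos heq.symm).symm.trans h')

theorem weightedTotalDegree_mul [IsDomain R] (w : σ → ℕ) {p q : MvPolynomial σ R} (hp : p ≠ 0)
    (hq : q ≠ 0) :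
    weightedTotalDegree w (p * q) = weightedTotalDegree w p + weightedTotalDegree w q := by
  refine (weightedTotalDegree_mul_le w p q).antisymm ?_
  by_contra! hlt
  have h := weightedHomogeneousComponent_add_mul w (le_refl (weightedTotalDegree w p))
    (le_refl (weightedTotalDegree w q))
  rw [weightedHomogeneousComponent_eq_zero _ _ hlt] at h
  exact mul_ne_zero (weightedHomogeneousComponent_weightedTotalDegree_ne_zero w hp)
    (weightedHomogeneousComponent_weightedTotalDegree_ne_zero w hq) h.symm

variable {F : Type*} [Field F]

theorem lastPiece_mul (α : Fin 2 → ℕ) {p q : PlanePoly F} (hp : p ≠ 0) (hq : q ≠ 0) :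
    lastPiece α (p * q) = lastPiece α p * lastPiece α q := by
  rw [lastPiece, weightedTotalDegree_mul α hp hq]
  exact weightedHomogeneousComponent_add_mul α le_rfl le_rfl

theorem lastPiece_ne_zero (α : Fin 2 → ℕ) {p : PlanePoly F} (hp : p ≠ 0) : lastPiece α p ≠ 0 :=
  weightedHomogeneousComponent_weightedTotalDegree_ne_zero α hp

theorem lastPiece_map {K : Type*} [Field K] (φ : F →+* K) (α : Fin 2 → ℕ) (f : PlanePoly F) :
    lastPiece α (map φ f) = map φ (lastPiece α f) := by
  classical
  have h : weightedTotalDegree α (map φ f) = weightedTotalDegree α f := by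
    rw [weightedTotalDegree, weightedTotalDegree, support_map_of_injective _ φ.injective]
  ext d
  rw [lastPiece, lastPiece, h, coeff_map, coeff_weightedHomogeneousComponent,
    coeff_weightedHomogeneousComponent, coeff_map, apply_ite φ, map_zero]

theorem jacobianIdeal_map {K : Type*} [Field K] (φ : F →+* K) (g : PlanePoly F) :
    jacobianIdeal (map φ g) = (jacobianIdeal g).map (map φ) := by
  rw [jacobianIdeal, jacobianIdeal, Ideal.map_span, Set.image_pair, pderiv_map, pderiv_map]

/-- An ideal of finite codimension contains nonzero polynomials in `x` alone and in `y`
alone. -/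
theorem exists_aeval_X_mem_of_finiteDimensional {I : Ideal (PlanePoly F)}
    [FiniteDimensional F (PlanePoly F ⧸ I)] (i : Fin 2) :
    ∃ p : Polynomial F, p ≠ 0 ∧ Polynomial.aeval (X i : PlanePoly F) p ∈ I := by
  obtain ⟨p, hp, h⟩ :=
    Algebra.IsAlgebraic.isAlgebraic (R := F) (Ideal.Quotient.mkₐ F I (X i))
  refine ⟨p, hp, ?_⟩
  rw [Polynomial.aeval_algHom_apply] at h
  exact Ideal.Quotient.eq_zero_iff_mem.mp h

theorem degreeOf_aeval_X_eq_zero {i j : Fin 2} (hij : j ≠ i) (p : Polynomial F) :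
    degreeOf j (Polynomial.aeval (X i : PlanePoly F) p) = 0 := by
  have hv : (Polynomial.aeval (X i : PlanePoly F) p) ∈ supported F {i} := by simp [supported]
  rw [mem_supported] at hv
  by_contra h
  exact hij (hv ((mem_vars_iff_degreeOf_ne_zero).mpr h))

/-- A polynomial dividing a polynomial in `x` alone and a polynomial in `y` alone is constant. -/
theorem exists_eq_C_of_dvd_aeval_X {t : PlanePoly F}
    (h : ∀ i, ∃ p : Polynomial F, p ≠ 0 ∧ t ∣ Polynomial.aeval (X i : PlanePoly F) p) :
    ∃ c, t = C c := by
  have hdeg : ∀ i j : Fin 2, j ≠ i → degreeOf j t = 0 := by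
    intro i j hij
    obtain ⟨p, hp, q, hq⟩ := h i
    have hne : Polynomial.aeval (X i : PlanePoly F) p ≠ 0 := by
      intro h0
      exact hp ((transcendental_iff.mp (transcendental_X F i)) p h0)
    have h1 := degreeOf_aeval_X_eq_zero hij p
    rw [hq] at hne h1
    rw [degreeOf_mul_eq (left_ne_zero_of_mul hne) (right_ne_zero_of_mul hne)] at h1
    omega
  have h0 : ∀ j, degreeOf j t = 0 := by
    intro j
    fin_cases j
    · exact hdeg 1 0 (by decide)
    · exact hdeg 0 1 (by decide)
  refine ⟨coeff 0 t, totalDegree_eq_zero_iff_eq_C.mp ?_⟩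
  rw [MvPolynomial.totalDegree_eq_zero_iff]
  intro m hm j
  have := monomial_le_degreeOf j hm
  rw [h0 j] at this
  omega

theorem isUnit_of_lastPiece_eq_C {α : Fin 2 → ℕ} (hα : ∀ i, 0 < α i) {h : PlanePoly F}
    (hh : h ≠ 0) {c : F} (hc : lastPiece α h = C c) : IsUnit h := by
  have hc0 : c ≠ 0 := by
    rintro rfl
    exact lastPiece_ne_zero α hh (by rw [hc, C_0])
  have hdeg : weightedTotalDegree α h = 0 := by
    refine IsWeightedHomogeneous.inj_right (w := α) (lastPiece_ne_zero α hh)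
      (weightedHomogeneousComponent_isWeightedHomogeneous _ _) ?_
    rw [hc]
    exact isWeightedHomogeneous_C α c
  have hC : h = C (coeff 0 h) := by
    refine totalDegree_eq_zero_iff_eq_C.mp ((totalDegree_eq_zero_iff _ _).mpr fun m hm i => ?_)
    have h1 := le_weightedTotalDegree α hm
    rw [hdeg] at h1
    by_contra hmi
    have h2 := Finsupp.le_weight α (hα i).ne' m
    omega
  rw [hC] at hh ⊢
  exact (isUnit_iff_ne_zero.mpr fun h0 => hh (by rw [h0, C_0])).map C

/-- If the Jacobian ideal of the top weighted piece of `f` contains nonzero polynomials in `x`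
alone and in `y` alone, then `f` is square-free: a multiple factor of `f` has a top piece whose
square divides that of `f`, so that it divides both partial derivatives. -/
theorem squarefree_of_aeval_X_mem_jacobianIdeal {α : Fin 2 → ℕ} (hα : ∀ i, 0 < α i)
    {f : PlanePoly F} (hf : f ≠ 0)
    (h : ∀ i, ∃ p : Polynomial F, p ≠ 0 ∧
      Polynomial.aeval (X i : PlanePoly F) p ∈ jacobianIdeal (lastPiece α f)) :
    Squarefree f := by
  rintro a ⟨q, rfl⟩
  have ha : a ≠ 0 := left_ne_zero_of_mul (left_ne_zero_of_mul hf)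
  have hq : q ≠ 0 := right_ne_zero_of_mul hf
  rw [lastPiece_mul α (mul_ne_zero ha ha) hq, lastPiece_mul α ha ha] at h
  have hle : jacobianIdeal (lastPiece α a * lastPiece α a * lastPiece α q) ≤
      Ideal.span {lastPiece α a} := by
    have hd : ∀ i, pderiv i (lastPiece α a * lastPiece α a * lastPiece α q) ∈
        Ideal.span {lastPiece α a} := by
      intro i
      rw [Ideal.mem_span_singleton, pderiv_mul, pderiv_mul]
      exact ⟨2 * pderiv i (lastPiece α a) * lastPiece α q +
        lastPiece α a * pderiv i (lastPiece α q), by ring⟩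
    rw [jacobianIdeal, Ideal.span_le, Set.insert_subset_iff, Set.singleton_subset_iff]
    exact ⟨hd 0, hd 1⟩
  obtain ⟨c, hc⟩ := exists_eq_C_of_dvd_aeval_X (t := lastPiece α a) fun i => by
    obtain ⟨p, hp, hmem⟩ := h i
    exact ⟨p, hp, Ideal.mem_span_singleton.mp (hle hmem)⟩
  exact isUnit_of_lastPiece_eq_C hα ha hc

theorem IsTame.ne_zero {f : PlanePoly F} (hf : IsTame f) : f ≠ 0 := by
  rintro rfl
  obtain ⟨α, -, hfin⟩ := hf
  obtain ⟨p, hp, hmem⟩ := exists_aeval_X_mem_of_finiteDimensional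
    (I := jacobianIdeal (lastPiece α (0 : PlanePoly F))) 0
  have : Polynomial.aeval (X 0 : PlanePoly F) p = 0 := by
    simpa [jacobianIdeal, lastPiece] using hmem
  exact hp ((transcendental_iff.mp (transcendental_X F 0)) p this)

theorem IsTame.squarefree_map {K : Type*} [Field K] (φ : F →+* K) {f : PlanePoly F}
    (hf : IsTame f) : Squarefree (map φ f) := by
  have hf0 := hf.ne_zero
  obtain ⟨α, hα, hfin⟩ := hf
  refine squarefree_of_aeval_X_mem_jacobianIdeal hα
    ((map_ne_zero_iff _ (map_injective φ φ.injective)).mpr hf0) fun i => ?_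
  obtain ⟨p, hp, hmem⟩ := exists_aeval_X_mem_of_finiteDimensional
    (I := jacobianIdeal (lastPiece α f)) i
  refine ⟨p.map φ, (Polynomial.map_ne_zero_iff φ.injective).mpr hp, ?_⟩
  rw [lastPiece_map, jacobianIdeal_map]
  have := Ideal.mem_map_of_mem (map φ) hmem
  convert this using 1
  rw [Polynomial.aeval_def, Polynomial.aeval_def, Polynomial.eval₂_map, Polynomial.hom_eval₂,
    map_X]
  congr 1
  ext a
  simp [algebraMap_eq]

end Squarefree

theorem free_and_finrank_scalarExtension {k : Type*} [Field k] (K : Type*) [Field K] [Algebra k K]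
    {f : PlanePoly k} (hf : f ≠ 0) :
    Module.Free (PlanePoly K) (ScalarExtension k K (tangentForms f)) ∧
      Module.finrank (PlanePoly K) (ScalarExtension k K (tangentForms f)) = 2 := by
  obtain ⟨b⟩ := nonempty_basis_tangentForms hf
  let b' := ScalarExtension.basis K b
  exact ⟨Module.Free.of_basis b', by simpa using Module.finrank_eq_card_basis b'⟩

end TamePlaneCurve

end

theorem proposition4 {k : Type*} [Field k] [Algebra k ℂ]
    {kbar : Type*} [Field kbar] [Algebra k kbar] [IsAlgClosure k kbar]
    (f : TamePlaneCurve.PlanePoly k) (hf : TamePlaneCurve.IsTame f)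
    (hsing : TamePlaneCurve.HasOnlyQuasiHomogeneousSingularities f) :
    (Module.Free (TamePlaneCurve.PlanePoly kbar)
        (TamePlaneCurve.ScalarExtension k kbar (TamePlaneCurve.tangentForms f)) ∧
      Module.finrank (TamePlaneCurve.PlanePoly kbar)
        (TamePlaneCurve.ScalarExtension k kbar (TamePlaneCurve.tangentForms f)) = 2) ∧
    ∃ K : IntermediateField k kbar, FiniteDimensional k K ∧
      (Module.Free (TamePlaneCurve.PlanePoly K)
          (TamePlaneCurve.ScalarExtension k K (TamePlaneCurve.tangentForms f)) ∧
        Module.finrank (TamePlaneCurve.PlanePoly K)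
          (TamePlaneCurve.ScalarExtension k K (TamePlaneCurve.tangentForms f)) = 2) ∧
      TamePlaneCurve.IsFreeDivisor (MvPolynomial.map (algebraMap k K) f) := by
  refine ⟨TamePlaneCurve.free_and_finrank_scalarExtension kbar hf.ne_zero, ⊥, inferInstance,
    TamePlaneCurve.free_and_finrank_scalarExtension _ hf.ne_zero, hf.squarefree_map _, ?_⟩
  obtain ⟨b⟩ := TamePlaneCurve.nonempty_basis_logVectorFields
    ((map_ne_zero_iff _ (MvPolynomial.map_injective (algebraMap k (⊥ : IntermediateField k kbar))
      (algebraMap k _).injective)).mpr hf.ne_zero)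
  exact Module.Free.of_basis b
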